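/- Let $G$ be a finite simple graph of order $n$ with vertex connectivity $r\ge 1$ and minimum degree $\delta$, where $n\ge 2(\delta+1)-r$. Here the vertex connectivity is the minimum cardinality of a set $S$ of vertices such that $G-S$ is disconnected or a single vertex. Let $\tau(G)$ denote the number of spanning trees of $G$. Then $$\tau(G)\le r\,n^{r-1}(\delta+1)^{\delta-r}(r+n-\delta-1)^{n-\delta-2},$$ and equality holds if and only if $G\cong K_r\vee(K_{\delta-r+1}\cup K_{n-\delta-1})$, where $K_m$ is the complete graph on $m$ vertices, $\cup$ is the disjoint union of graphs, and $\vee$ is the join (the disjoint union together with all edges between the two graphs). -/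

import Mathlib

namespace SpanningTreeCount

/-- The number `τ(G)` of spanning trees of `G`: the number of subgraphs of `G` on the whole vertex
set that are trees. -/
noncomputable def numSpanningTrees {V : Type*} (G : SimpleGraph V) : ℕ :=
  {T : SimpleGraph V | T ≤ G ∧ T.IsTree}.ncard

/-- `S` is a vertex cut of `G` if `G - S` is disconnected or a single vertex. -/
def IsVertexCut {V : Type*} (G : SimpleGraph V) (S : Finset V) : Prop :=
  ¬ (G.induce {v | v ∉ S}).Preconnected ∨ ∃ v, {u | u ∉ S} = ({v} : Set V)

/-- The vertex connectivity `κ(G)`: the minimum cardinality of a vertex cut. For a finite graph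
with at least one vertex this minimum is attained; it is `0` if `G` is disconnected. -/
noncomputable def vertexConnectivity {V : Type*} (G : SimpleGraph V) : ℕ :=
  sInf {k | ∃ S : Finset V, IsVertexCut G S ∧ S.card = k}

/-- The join `G ∨ H`: the disjoint union of `G` and `H` together with all edges between them. -/
def join {V W : Type*} (G : SimpleGraph V) (H : SimpleGraph W) : SimpleGraph (V ⊕ W) :=
  (SimpleGraph.sum G H) ⊔ completeBipartiteGraph V W

/-- The graph `K_r ∨ (K_a ∪ K_b)`; the complete graph on `Fin m` is `⊤`. -/
def joinOfCliques (r a b : ℕ) : SimpleGraph (Fin r ⊕ (Fin a ⊕ Fin b)) :=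
  join (⊤ : SimpleGraph (Fin r))
    (SimpleGraph.sum (⊤ : SimpleGraph (Fin a)) (⊤ : SimpleGraph (Fin b)))

end SpanningTreeCount

/-! Take a minimum vertex cut `S`. Since `r ≤ δ`, the bound on `n` leaves at least two vertices
outside `S`, so `G - S` is disconnected. Grouping its components into two sides makes `G` a spanning
subgraph of `K_r ∨ (K_p ∪ K_q)` with `p ≤ q`, and the degree of a vertex on the smaller side gives
`p ≥ δ - r + 1`.

The larger graph has `r n^(r-1) (p+r)^(p-1) (q+r)^(q-1)` spanning trees
(`numSpanningTrees_partitionGraph`, from the matrix-tree theorem). For fixed `p + q`, strict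
log-convexity of `m ↦ (m+r+1)^m` (`add_pow_mul_add_pow_lt`) makes this largest only at `p = δ - r +
1`. Adding an edge to reach a connected graph strictly increases the count (`numSpanningTrees_lt`),
which settles equality. -/

namespace SpanningTreeCount

open Finset Matrix

/-! ### Spanning trees as rooted parent functions -/

section ParentFunctions

variable {V : Type*} {root : V}

/-- A parent function is rooted if iterating it from any vertex leads to the root; equivalently,
some height function decreases from every vertex to its parent. -/
def IsRooted (f : {v : V // v ≠ root} → V) : Prop :=
  ∃ h : V → ℕ, ∀ v, h (f v) < h v

/-- The graph whose edges join the vertices to their parents. -/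
def parentGraph (f : {v : V // v ≠ root} → V) : SimpleGraph V :=
  SimpleGraph.fromRel fun u v ↦ ∃ hu : u ≠ root, f ⟨u, hu⟩ = v

theorem IsRooted.apply_ne {f : {v : V // v ≠ root} → V} (hf : IsRooted f)
    (v : {v : V // v ≠ root}) : f v ≠ v := by
  obtain ⟨h, hh⟩ := hf
  intro e
  have := hh v
  rw [e] at this
  exact lt_irrefl _ this

theorem IsRooted.parentGraph_adj_apply {f : {v : V // v ≠ root} → V} (hf : IsRooted f)
    (v : {v : V // v ≠ root}) : (parentGraph f).Adj v (f v) :=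
  ⟨(hf.apply_ne v).symm, Or.inl ⟨v.2, rfl⟩⟩

theorem IsRooted.connected_parentGraph {f : {v : V // v ≠ root} → V} (hf : IsRooted f) :
    (parentGraph f).Connected := by
  have key : ∀ v, (parentGraph f).Reachable v root := by
    obtain ⟨h, hh⟩ := id hf
    intro v
    induction hk : h v using Nat.strong_induction_on generalizing v with
    | _ k ih =>
      by_cases hv : v = root
      · rw [hv]
      · exact (hf.parentGraph_adj_apply ⟨v, hv⟩).reachable.trans
          (ih _ (hk ▸ hh ⟨v, hv⟩) _ rfl)
  have : Nonempty V := ⟨root⟩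
  exact ⟨fun u v ↦ (key u).trans (key v).symm⟩

/-- Every edge is the arc of some non-root vertex, so a connected graph has at most `|V| - 1` edges
here. -/
theorem IsRooted.isTree_parentGraph [Finite V] {f : {v : V // v ≠ root} → V} (hf : IsRooted f) :
    (parentGraph f).IsTree := by
  classical
  have := Fintype.ofFinite V
  rw [SimpleGraph.isTree_iff_connected_and_card]
  refine ⟨hf.connected_parentGraph, le_antisymm ?_
    hf.connected_parentGraph.card_vert_le_card_edgeSet_add_one⟩
  have hsub : (parentGraph f).edgeSet ⊆ Set.range fun v : {v : V // v ≠ root} ↦ s(v.1, f v) := by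
    intro e
    induction e using Sym2.ind with
    | _ u v =>
      rintro ⟨-, ⟨hu, h⟩ | ⟨hv, h⟩⟩
      · exact ⟨⟨u, hu⟩, congrArg (s(u, ·)) h⟩
      · exact ⟨⟨v, hv⟩, (congrArg (s(v, ·)) h).trans Sym2.eq_swap⟩
  have h1 : Nat.card (parentGraph f).edgeSet ≤ Nat.card {v : V // v ≠ root} :=
    (Nat.card_mono (Set.toFinite _) hsub).trans (Finite.card_range_le _)
  have h2 : Nat.card {v : V // v ≠ root} + 1 = Nat.card V := by
    have := Fintype.card_pos_iff.2 ⟨root⟩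
    simp only [Nat.card_eq_fintype_card, Fintype.card_subtype_compl, Fintype.card_unique]
    omega
  omega

theorem IsRooted.injOn_parentGraph :
    Set.InjOn (parentGraph (root := root)) {f : {v : V // v ≠ root} → V | IsRooted f} := by
  intro f hf g hg hfg
  obtain ⟨h, hh⟩ := id hf
  funext v
  induction hk : h v using Nat.strong_induction_on generalizing v with
  | _ k ih =>
    -- This edge is the `g`-arc of `v` or of `f v`. In the second case induction gives `f (f v) =
    -- v`, contradicting the decrease of `h`.
    have hadj : (parentGraph g).Adj v (f v) := hfg ▸ IsRooted.parentGraph_adj_apply hf v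
    obtain ⟨-, ⟨_, h1⟩ | ⟨hu, h1⟩⟩ := hadj
    · exact h1.symm
    · have h2 := ih _ (hk ▸ hh v) ⟨f v, hu⟩ rfl
      rw [h1] at h2
      have h3 := hh ⟨f v, hu⟩
      rw [h2] at h3
      have h4 := hh v
      exact absurd (h3.trans h4) (lt_irrefl _)

theorem exists_isRooted_parentGraph_eq {T : SimpleGraph V} (hT : T.IsTree) (root : V) :
    ∃ f : {v : V // v ≠ root} → V, IsRooted f ∧ parentGraph f = T := by
  have step : ∀ v : {v : V // v ≠ root}, ∃ u, T.Adj v u ∧ T.dist u root < T.dist v root := by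
    rintro ⟨v, hv⟩
    obtain ⟨p, hp⟩ := hT.connected.exists_walk_length_eq_dist v root
    cases p with
    | nil => exact absurd rfl hv
    | cons hadj q =>
      refine ⟨_, hadj, ?_⟩
      change T.dist _ root < T.dist v root
      have := SimpleGraph.dist_le q
      rw [SimpleGraph.Walk.length_cons] at hp
      omega
  choose f hf hlt using step
  have hr : IsRooted f := ⟨fun v ↦ T.dist v root, hlt⟩
  refine ⟨f, hr, ?_⟩
  have hle : parentGraph f ≤ T := by
    rintro u v ⟨-, ⟨hu, rfl⟩ | ⟨hv, rfl⟩⟩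
    · exact hf ⟨u, hu⟩
    · exact (hf ⟨v, hv⟩).symm
  exact le_antisymm hle
    ((SimpleGraph.isTree_iff_minimal_connected.1 hT).2 hr.connected_parentGraph hle)

/-- Spanning trees correspond to rooted parent functions along edges of the graph. -/
theorem numSpanningTrees_eq_ncard_isRooted [Finite V] (G : SimpleGraph V) (root : V) :
    numSpanningTrees G =
      {f : {v : V // v ≠ root} → V | (∀ v : {v : V // v ≠ root}, G.Adj v (f v)) ∧ IsRooted f}.ncard := by
  rw [numSpanningTrees, ← Set.InjOn.ncard_image
    (IsRooted.injOn_parentGraph.mono fun f hf ↦ hf.2)]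
  congr 1
  ext T
  constructor
  · rintro ⟨hle, hT⟩
    obtain ⟨f, hf, rfl⟩ := exists_isRooted_parentGraph_eq hT root
    exact ⟨f, ⟨fun v ↦ hle (hf.parentGraph_adj_apply v), hf⟩, rfl⟩
  · rintro ⟨f, ⟨hadj, hf⟩, rfl⟩
    refine ⟨?_, hf.isTree_parentGraph⟩
    rintro u v ⟨-, ⟨hu, rfl⟩ | ⟨hv, rfl⟩⟩
    · exact hadj ⟨u, hu⟩
    · exact (hadj ⟨v, hv⟩).symm

end ParentFunctions

/-! ### The matrix-tree theorem -/

section MatrixTree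

variable {V : Type*} [Fintype V] [DecidableEq V] {root : V}

/-- The reduced Laplacian of the directed graph with the arcs from each vertex to its parent. -/
def parentMatrix (f : {v : V // v ≠ root} → V) :
    Matrix {v : V // v ≠ root} {v : V // v ≠ root} ℚ :=
  fun v u ↦ (if v = u then 1 else 0) - if f v = u then 1 else 0

/-- Ordering by height makes the matrix block triangular with identity diagonal blocks. -/
theorem IsRooted.det_parentMatrix {f : {v : V // v ≠ root} → V} (hf : IsRooted f) :
    (parentMatrix f).det = 1 := by
  obtain ⟨h, hh⟩ := hf
  have hb : (parentMatrix f).BlockTriangular fun v ↦ OrderDual.toDual (h v) := by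
    intro i j hij
    have hij : h i < h j := hij
    have h1 : i ≠ j := by rintro rfl; exact lt_irrefl _ hij
    have h2 : f i ≠ j := by
      intro e
      have := hh i
      rw [e] at this
      exact lt_asymm hij this
    simp [parentMatrix, h1, h2]
  rw [hb.det]
  refine Finset.prod_eq_one fun a _ ↦ ?_
  suffices h1 : (parentMatrix f).toSquareBlock (fun v ↦ OrderDual.toDual (h v)) a = 1 by
    rw [h1, Matrix.det_one]
  ext ⟨i, hi⟩ ⟨j, hj⟩
  have h2 : f i ≠ j := by
    intro e
    have := hh i
    rw [e] at this
    have e' : h i = h j := OrderDual.toDual.injective (hi.trans hj.symm)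
    omega
  simp [Matrix.toSquareBlock, Matrix.toSquareBlockProp, parentMatrix, h2, Matrix.one_apply]

/-- The indicator of the vertices whose forward orbit misses the root is a nonzero kernel vector. -/
theorem det_parentMatrix_of_not_isRooted {f : {v : V // v ≠ root} → V} (hf : ¬ IsRooted f) :
    (parentMatrix f).det = 0 := by
  let F : V → V := fun v ↦ if hv : v = root then root else f ⟨v, hv⟩
  have hF : ∀ v : {v : V // v ≠ root}, F v = f v := fun v ↦ dif_neg v.2
  let U : V → Prop := fun v ↦ ∀ k, F^[k] v ≠ root
  have hUf : ∀ v : {v : V // v ≠ root}, U (f v) ↔ U v := by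
    intro v
    rw [← hF]
    refine ⟨fun h k ↦ ?_, fun h k ↦ h (k + 1)⟩
    cases k with
    | zero => exact v.2
    | succ k => exact h k
  have hUr : ∀ v, U v → v ≠ root := fun v h ↦ h 0
  have hU : ∃ v, U v := by
    by_contra! hne
    have hne' : ∀ v, ∃ k, F^[k] v = root := by
      intro v
      by_contra! h
      exact hne v h
    refine hf ⟨fun v ↦ Nat.find (hne' v), fun v ↦ ?_⟩
    have hs := Nat.find_spec (hne' v)
    obtain ⟨k, hk⟩ : ∃ k, Nat.find (hne' v) = k + 1 := by
      refine Nat.exists_eq_succ_of_ne_zero fun h0 ↦ v.2 ?_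
      rwa [h0] at hs
    rw [hk, Function.iterate_succ_apply, hF] at hs
    have := Nat.find_min' (hne' (f v)) hs
    change Nat.find (hne' (f v)) < Nat.find (hne' v)
    omega
  classical
  rw [← Matrix.exists_mulVec_eq_zero_iff]
  refine ⟨fun v ↦ if U v then 1 else 0, ?_, ?_⟩
  · obtain ⟨v, hv⟩ := hU
    intro h
    have := congrFun h ⟨v, hUr v hv⟩
    simp [hv] at this
  · funext v
    simp only [Matrix.mulVec, dotProduct, parentMatrix, sub_mul, ite_mul, one_mul, zero_mul,
      Finset.sum_sub_distrib, Finset.sum_ite_eq, Finset.mem_univ, if_true, Pi.zero_apply]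
    rw [sub_eq_zero]
    by_cases hr : f v = root
    · have : ¬ U v := by
        rw [← hUf, hr]
        exact fun h ↦ hUr _ h rfl
      rw [if_neg this, Finset.sum_eq_zero]
      intro u _
      rw [if_neg]
      rw [hr]
      exact u.2.symm
    · rw [Finset.sum_eq_single ⟨f v, hr⟩]
      · simp [hUf]
      · intro u _ hu
        rw [if_neg]
        exact fun e ↦ hu (Subtype.ext e.symm)
      · simp

/-- **Kirchhoff's matrix-tree theorem.** -/
theorem numSpanningTrees_eq_det (G : SimpleGraph V) [DecidableRel G.Adj] (root : V) :
    (numSpanningTrees G : ℚ) =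
      ((G.lapMatrix ℚ).submatrix (Subtype.val : {v : V // v ≠ root} → V) Subtype.val).det := by
  classical
  -- Row `v` is the sum of `e_v - e_w` over neighbours `w`, with `e_root = 0`. Multilinearity
  -- expands the determinant over all choices of a parent for each `v`.
  have hrow : (G.lapMatrix ℚ).submatrix (Subtype.val : {v : V // v ≠ root} → V) Subtype.val =
      fun v : {v : V // v ≠ root} ↦ ∑ w, (if G.Adj v w then (1 : ℚ) else 0) • fun u : {v : V // v ≠ root} ↦
        (if v = u then (1 : ℚ) else 0) - if w = u then 1 else 0 := by
    ext v u
    simp only [Matrix.submatrix_apply, SimpleGraph.lapMatrix, SimpleGraph.degMatrix,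
      Matrix.sub_apply, Matrix.diagonal_apply, SimpleGraph.adjMatrix_apply, Finset.sum_apply,
      Pi.smul_apply, smul_eq_mul, mul_sub, Finset.sum_sub_distrib, ← Finset.sum_mul,
      ← SimpleGraph.degree_eq_sum_if_adj, Subtype.ext_iff]
    simp
  rw [hrow]
  change _ = (Matrix.detRowAlternating (R := ℚ)).toMultilinearMap _
  rw [MultilinearMap.map_sum]
  simp only [MultilinearMap.map_smul_univ]
  rw [numSpanningTrees_eq_ncard_isRooted G root, Set.ncard_eq_toFinset_card',
    Finset.card_eq_sum_ones, Nat.cast_sum, Set.toFinset_ofPred, Finset.sum_filter]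
  refine Finset.sum_congr rfl fun f _ ↦ ?_
  change _ = _ • (parentMatrix f).det
  by_cases hadj : ∀ v : {v : V // v ≠ root}, G.Adj v (f v)
  · by_cases hf : IsRooted f
    · simp [hadj, hf, hf.det_parentMatrix]
    · simp [hf, det_parentMatrix_of_not_isRooted hf]
  · rw [if_neg fun h ↦ hadj h.1]
    push Not at hadj
    obtain ⟨v, hv⟩ := hadj
    rw [Finset.prod_eq_zero (Finset.mem_univ v) (if_neg hv), zero_smul]

end MatrixTree

/-! ### Counting spanning trees of `K_r ∨ (K_p ∪ K_q)` -/

section PartitionGraph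

variable {V : Type*}

/-- The graph obtained from the complete graph by deleting all edges between the class `1` and
the class `2` of a colouring with the colours `0, 1, 2`. -/
def partitionGraph (c : V → Fin 3) : SimpleGraph V where
  Adj u v := u ≠ v ∧ (c u = 0 ∨ c v = 0 ∨ c u = c v)
  symm := ⟨fun _ _ h ↦ ⟨h.1.symm, by tauto⟩⟩
  loopless := ⟨fun _ h ↦ h.1 rfl⟩

instance [DecidableEq V] (c : V → Fin 3) : DecidableRel (partitionGraph c).Adj :=
  fun u v ↦ inferInstanceAs (Decidable (u ≠ v ∧ (c u = 0 ∨ c v = 0 ∨ c u = c v)))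

theorem connected_partitionGraph {c : V → Fin 3} {v₀ : V} (h₀ : c v₀ = 0) :
    (partitionGraph c).Connected := by
  have key : ∀ v, (partitionGraph c).Reachable v v₀ := by
    intro v
    by_cases h : v = v₀
    · rw [h]
    · exact SimpleGraph.Adj.reachable ⟨h, Or.inr (Or.inl h₀)⟩
  have : Nonempty V := ⟨v₀⟩
  exact ⟨fun u v ↦ (key u).trans (key v).symm⟩

/-- The adjacency of the classes of `partitionGraph`. -/
def classMatrix : Matrix (Fin 3) (Fin 3) ℚ := !![1, 1, 1; 1, 1, 0; 1, 0, 1]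

theorem classMatrix_apply (i j : Fin 3) :
    classMatrix i j = if i = 0 ∨ j = 0 ∨ i = j then 1 else 0 := by
  fin_cases i <;> fin_cases j <;> simp [classMatrix]

theorem sum_comp_eq_sum_card {α : Type*} [Fintype α] (c : α → Fin 3) (g : Fin 3 → ℚ) :
    ∑ v, g (c v) = ∑ i, (#{v | c v = i} : ℚ) * g i := by
  rw [← Finset.sum_fiberwise univ c]
  refine Finset.sum_congr rfl fun i _ ↦ ?_
  rw [Finset.sum_congr rfl (g := fun _ ↦ g i) fun v hv ↦ by rw [(Finset.mem_filter.1 hv).2]]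
  simp

theorem prod_comp_eq_prod_pow_card {α : Type*} [Fintype α] (c : α → Fin 3) (g : Fin 3 → ℚ) :
    ∏ v, g (c v) = ∏ i, g i ^ #{v | c v = i} := by
  rw [← Finset.prod_fiberwise univ c]
  refine Finset.prod_congr rfl fun i _ ↦ ?_
  rw [Finset.prod_congr rfl (g := fun _ ↦ g i) fun v hv ↦ by rw [(Finset.mem_filter.1 hv).2]]
  simp

/-- The determinant of a diagonal matrix minus a matrix of rank at most three, both depending only
on a colouring of the indices. -/
theorem det_diagonal_sub_comp {α : Type*} [Fintype α] [DecidableEq α] (c : α → Fin 3)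
    (d : Fin 3 → ℚ) (hd : ∀ i, d i ≠ 0) (B : Matrix (Fin 3) (Fin 3) ℚ) :
    (Matrix.diagonal (fun v ↦ d (c v)) - Matrix.of fun v u ↦ B (c v) (c u)).det =
      (∏ i, d i ^ #{v | c v = i}) *
        (1 - Matrix.of fun i j ↦ B i j * (#{v | c v = j} / d j)).det := by
  -- The matrix factors as `D (1 - Q R)`, and `det (1 - Q R) = det (1 - R Q)` is a 3×3 determinant.
  let Q : Matrix α (Fin 3) ℚ := fun v i ↦ if c v = i then (d i)⁻¹ else 0
  let R : Matrix (Fin 3) α ℚ := fun i v ↦ B i (c v)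
  have h1 : (Matrix.diagonal (fun v ↦ d (c v)) - Matrix.of fun v u ↦ B (c v) (c u)) =
      Matrix.diagonal (fun v ↦ d (c v)) * (1 - Q * R) := by
    ext v u
    rw [mul_sub, mul_one, Matrix.sub_apply, Matrix.sub_apply, Matrix.diagonal_mul,
      Matrix.mul_apply]
    simp [Q, R, hd]
  have h2 : R * Q = Matrix.of fun i j ↦ B i j * (#{v | c v = j} / d j) := by
    ext i j
    rw [Matrix.mul_apply, Matrix.of_apply]
    change ∑ v, B i (c v) * (if c v = j then (d j)⁻¹ else 0) = _
    rw [sum_comp_eq_sum_card c fun k ↦ B i k * if k = j then (d j)⁻¹ else 0]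
    simp
    ring
  rw [h1, Matrix.det_mul, Matrix.det_diagonal, Matrix.det_one_sub_mul_comm, h2,
    prod_comp_eq_prod_pow_card]

theorem numSpanningTrees_partitionGraph [Fintype V] (c : V → Fin 3) {r a b : ℕ}
    (h0 : #{v | c v = 0} = r + 1) (h1 : #{v | c v = 1} = a + 1) (h2 : #{v | c v = 2} = b + 1) :
    numSpanningTrees (partitionGraph c) =
      (r + 1) * (r + a + b + 3) ^ r * (a + r + 2) ^ a * (b + r + 2) ^ b := by
  classical
  obtain ⟨root, hroot⟩ : ∃ v, c v = 0 := by
    have : 0 < #{v | c v = 0} := by omega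
    obtain ⟨v, hv⟩ := Finset.card_pos.1 this
    exact ⟨v, (Finset.mem_filter.1 hv).2⟩
  -- Degree plus one: the extra one cancels the diagonal ones of `classMatrix`.
  let d : Fin 3 → ℚ := ![r + a + b + 3, a + r + 2, b + r + 2]
  have hd : ∀ i, d i ≠ 0 := by
    intro i
    fin_cases i <;> simp [d] <;> positivity
  have hdeg : ∀ v, ((partitionGraph c).degree v : ℚ) = d (c v) - 1 := by
    intro v
    have e1 : ∑ u, classMatrix (c v) (c u) = d (c v) := by
      rw [sum_comp_eq_sum_card c fun k ↦ classMatrix (c v) k, Fin.sum_univ_three, h0, h1, h2]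
      generalize c v = i
      fin_cases i <;> simp [d, classMatrix] <;> ring
    rw [SimpleGraph.degree_eq_sum_if_adj, ← e1, eq_sub_iff_add_eq,
      ← Finset.sum_erase_add _ _ (Finset.mem_univ v),
      ← Finset.sum_erase_add univ (fun u ↦ classMatrix (c v) (c u)) (Finset.mem_univ v),
      add_assoc]
    congr 1
    · refine Finset.sum_congr rfl fun u hu ↦ ?_
      have hu : v ≠ u := (Finset.ne_of_mem_erase hu).symm
      simp [classMatrix_apply, partitionGraph, hu]
    · simp [classMatrix_apply]
  let c' : {v : V // v ≠ root} → Fin 3 := fun v ↦ c v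
  have hcard : ∀ i, #{v | c' v = i} = #(({v | c v = i} : Finset V).erase root) := by
    intro i
    rw [← Finset.card_map (Function.Embedding.subtype _)]
    congr 1
    ext v
    simp [c', and_comm]
  have h0' : #{v | c' v = 0} = r := by
    rw [hcard, Finset.card_erase_of_mem (by simp [hroot]), h0, Nat.add_sub_cancel]
  have h1' : #{v | c' v = 1} = a + 1 := by
    rw [hcard, Finset.erase_eq_of_notMem (by simp [hroot]), h1]
  have h2' : #{v | c' v = 2} = b + 1 := by
    rw [hcard, Finset.erase_eq_of_notMem (by simp [hroot]), h2]
  have hlap : ((partitionGraph c).lapMatrix ℚ).submatrix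
      (Subtype.val : {v : V // v ≠ root} → V) Subtype.val =
      Matrix.diagonal (fun v ↦ d (c' v)) - Matrix.of fun v u ↦ classMatrix (c' v) (c' u) := by
    ext v u
    simp only [Matrix.submatrix_apply, SimpleGraph.lapMatrix, SimpleGraph.degMatrix,
      Matrix.sub_apply, Matrix.diagonal_apply, SimpleGraph.adjMatrix_apply, Matrix.of_apply,
      hdeg, classMatrix_apply, c']
    by_cases h : v = u
    · simp [h, partitionGraph]
    · have h' : (v : V) ≠ u := fun e ↦ h (Subtype.ext e)
      simp [h, h', partitionGraph]
  have hfin := numSpanningTrees_eq_det (partitionGraph c) root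
  rw [hlap, det_diagonal_sub_comp c' d hd, Fin.prod_univ_three, Matrix.det_fin_three] at hfin
  have e0 : (r + a + b + 3 : ℚ) ≠ 0 := hd 0
  have e1 : (a + r + 2 : ℚ) ≠ 0 := hd 1
  have e2 : (b + r + 2 : ℚ) ≠ 0 := hd 2
  simp only [Matrix.sub_apply, Matrix.of_apply, Matrix.one_apply, h0', h1', h2'] at hfin
  simp [d, classMatrix] at hfin
  have : (numSpanningTrees (partitionGraph c) : ℚ) =
      (r + 1) * (r + a + b + 3) ^ r * (a + r + 2) ^ a * (b + r + 2) ^ b := by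
    rw [hfin]
    field_simp
    ring
  exact_mod_cast this

end PartitionGraph

/-! ### Isomorphism invariance and monotonicity of the count -/

section Monotone

variable {V : Type*}

theorem numSpanningTrees_congr {W : Type*} {G : SimpleGraph V} {H : SimpleGraph W}
    (e : G ≃g H) : numSpanningTrees G = numSpanningTrees H := by
  refine Set.ncard_congr (fun T _ ↦ T.map e.toEmbedding.toEmbedding) ?_ ?_ ?_
  · rintro T ⟨hle, hT⟩
    refine ⟨?_, ((SimpleGraph.Iso.map e.toEquiv T).isTree_iff).1 hT⟩
    rintro _ _ ⟨-, u, v, huv, rfl, rfl⟩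
    exact e.map_adj_iff.2 (hle huv)
  · intro S T _ _ h
    exact SimpleGraph.map_injective _ h
  · rintro T ⟨hle, hT⟩
    refine ⟨T.map e.symm.toEmbedding.toEmbedding,
      ⟨?_, ((SimpleGraph.Iso.map e.symm.toEquiv T).isTree_iff).1 hT⟩, ?_⟩
    · rintro _ _ ⟨-, u, v, huv, rfl, rfl⟩
      exact e.symm.map_adj_iff.2 (hle huv)
    · rw [SimpleGraph.map_map]
      have : (e.toEmbedding.toEmbedding ∘ e.symm.toEmbedding.toEmbedding : W → W) = id :=
        funext e.apply_symm_apply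
      rw [this, SimpleGraph.map_id]

theorem numSpanningTrees_mono [Finite V] {G H : SimpleGraph V} (h : G ≤ H) :
    numSpanningTrees G ≤ numSpanningTrees H :=
  Set.ncard_le_ncard (fun _ hT ↦ ⟨hT.1.trans h, hT.2⟩) (Set.toFinite _)

/-- Any edge of `H` missing from `G` extends to a spanning tree of `H`. -/
theorem numSpanningTrees_lt [Finite V] {G H : SimpleGraph V} (h : G < H) (hH : H.Connected) :
    numSpanningTrees G < numSpanningTrees H := by
  refine Set.ncard_lt_ncard ⟨fun _ hT ↦ ⟨hT.1.trans h.le, hT.2⟩, fun hsub ↦ ?_⟩ (Set.toFinite _)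
  refine h.not_ge fun u v huv ↦ ?_
  have hle : SimpleGraph.edge u v ≤ H := by
    rw [SimpleGraph.edge_le_iff]
    exact Or.inr huv
  have hac : (SimpleGraph.edge u v).IsAcyclic := by
    have := SimpleGraph.isAcyclic_bot.sup_edge_of_not_reachable (V := V) (u := u) (v := v) (by
      rw [SimpleGraph.reachable_bot]
      exact huv.ne)
    rwa [bot_sup_eq] at this
  obtain ⟨T, hT⟩ := hH.exists_isTree_le_of_le_of_isAcyclic hle hac
  have hT' : T ∈ {T | T ≤ G ∧ T.IsTree} := hsub ⟨hT.2.1, hT.2.2⟩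
  exact hT'.1 (hT.1 (by simp [SimpleGraph.edge_adj, huv.ne]))

end Monotone

/-! ### Strict log-convexity -/

section Convexity

/-- With `x = a + 1 + s` the claim is `x^(2a+2) < (x²-1)^a (x+1)²`. Bernoulli's inequality for `(1 -
1/x²)^a` reduces it to `x⁴ < (x²-a)(x+1)²`. -/
theorem sq_add_pow_lt (s a : ℕ) (hs : 1 ≤ s) :
    (((a + 1 + s : ℕ) : ℚ) ^ (a + 1)) * ((a + 1 + s : ℕ) : ℚ) ^ (a + 1) <
      ((a + s : ℕ) : ℚ) ^ a * ((a + 2 + s : ℕ) : ℚ) ^ (a + 2) := by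
  obtain ⟨x, hx⟩ : ∃ x : ℚ, x = a + 1 + s := ⟨_, rfl⟩
  have hs' : (1 : ℚ) ≤ s := by exact_mod_cast hs
  have ha : (0 : ℚ) ≤ a := by positivity
  have hx0 : 0 < x := by linarith
  have e1 : ((a + 1 + s : ℕ) : ℚ) = x := by push_cast; linarith
  have e2 : ((a + s : ℕ) : ℚ) = x - 1 := by push_cast; linarith
  have e3 : ((a + 2 + s : ℕ) : ℚ) = x + 1 := by push_cast; linarith
  rw [e1, e2, e3]
  have hbern := one_add_mul_le_pow (a := -(1 / x ^ 2)) (by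
    have : 1 / x ^ 2 ≤ 1 := by
      rw [div_le_one (by positivity)]
      nlinarith
    linarith) a
  have hx1 : x ^ 2 - 1 = x ^ 2 * (1 + -(1 / x ^ 2)) := by field_simp; ring
  have key : x ^ 4 < (x ^ 2 - a) * (x + 1) ^ 2 := by
    have h1 : (x ^ 2 - x + 1) * (x + 1) ^ 2 ≤ (x ^ 2 - a) * (x + 1) ^ 2 :=
      mul_le_mul_of_nonneg_right (by linarith) (by positivity)
    have h2 : (x ^ 2 - x + 1) * (x + 1) ^ 2 = x ^ 4 + (x ^ 3 + x + 1) := by ring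
    have h3 : 0 < x ^ 3 + x + 1 := by positivity
    linarith
  have h4 : x ^ 2 * (x ^ 2) ^ a < (x ^ 2 - 1) ^ a * (x + 1) ^ 2 := by
    calc x ^ 2 * (x ^ 2) ^ a = x ^ 4 * ((x ^ 2) ^ a / x ^ 2) := by field_simp
      _ < (x ^ 2 - a) * (x + 1) ^ 2 * ((x ^ 2) ^ a / x ^ 2) :=
        mul_lt_mul_of_pos_right key (by positivity)
      _ = ((x ^ 2) ^ a * (1 + a * -(1 / x ^ 2))) * (x + 1) ^ 2 := by field_simp; ring
      _ ≤ ((x ^ 2) ^ a * (1 + -(1 / x ^ 2)) ^ a) * (x + 1) ^ 2 := by gcongr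
      _ = _ := by rw [← mul_pow, ← hx1]
  calc x ^ (a + 1) * x ^ (a + 1) = x ^ 2 * (x ^ 2) ^ a := by ring
    _ < _ := h4
    _ = ((x - 1) * (x + 1)) ^ a * (x + 1) ^ 2 := by ring
    _ = _ := by rw [mul_pow]; ring

/-- The sequence `m ↦ (m + s) ^ m` is strictly log-convex. -/
theorem add_pow_mul_add_pow_lt (s : ℕ) (hs : 1 ≤ s) {a b : ℕ} (hab : a < b) (k : ℕ) :
    (a + (k + 1) + s) ^ (a + (k + 1)) * (b + s) ^ b <
      (a + s) ^ a * (b + (k + 1) + s) ^ (b + (k + 1)) := by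
  let h : ℕ → ℚ := fun m ↦ ((m + s : ℕ) : ℚ) ^ m
  have hpos : ∀ m, 0 < h m := fun m ↦ by
    have : (0 : ℚ) < ((m + s : ℕ) : ℚ) := by exact_mod_cast (by omega : 0 < m + s)
    exact pow_pos this _
  -- Consecutive ratios increase, so `k + 1` steps up from `b` gain more than `k + 1` steps up from
  -- `a`.
  let ρ : ℕ → ℚ := fun m ↦ h (m + 1) / h m
  have hρ : StrictMono ρ := by
    refine strictMono_nat_of_lt_succ fun m ↦ ?_
    change h (m + 1) / h m < h (m + 2) / h (m + 1)
    rw [div_lt_div_iff₀ (hpos _) (hpos _), mul_comm (h (m + 2))]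
    exact sq_add_pow_lt s m hs
  have hmul : ∀ m, h (m + 1) = ρ m * h m := fun m ↦ (div_mul_cancel₀ _ (hpos m).ne').symm
  have hρpos : ∀ m, 0 < ρ m := fun m ↦ div_pos (hpos _) (hpos _)
  have key : ∀ k, h (a + k) * h b ≤ h a * h (b + k) := by
    intro k
    induction k with
    | zero => rfl
    | succ k ih =>
      rw [← add_assoc, ← add_assoc, hmul, hmul]
      calc ρ (a + k) * h (a + k) * h b = ρ (a + k) * (h (a + k) * h b) := by ring
        _ ≤ ρ (b + k) * (h a * h (b + k)) :=
          mul_le_mul (hρ.monotone (by omega)) ih (mul_pos (hpos _) (hpos _)).le (hρpos _).le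
        _ = _ := by ring
  have : h (a + (k + 1)) * h b < h a * h (b + (k + 1)) := by
    rw [← add_assoc, ← add_assoc, hmul, hmul]
    calc ρ (a + k) * h (a + k) * h b = ρ (a + k) * (h (a + k) * h b) := by ring
      _ ≤ ρ (a + k) * (h a * h (b + k)) := mul_le_mul_of_nonneg_left (key k) (hρpos _).le
      _ < ρ (b + k) * (h a * h (b + k)) :=
        mul_lt_mul_of_pos_right (hρ (by omega)) (mul_pos (hpos _) (hpos _))
      _ = _ := by ring
  simp only [h] at this
  exact_mod_cast this

end Convexity

/-! ### The extremal graph as a partition graph -/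

section Isomorphism

/-- The colouring of the vertices of `joinOfCliques` by the three cliques. -/
def cliqueColouring (r a b : ℕ) : Fin r ⊕ (Fin a ⊕ Fin b) → Fin 3 :=
  Sum.elim (fun _ ↦ 0) (Sum.elim (fun _ ↦ 1) fun _ ↦ 2)

theorem joinOfCliques_eq_partitionGraph (r a b : ℕ) :
    joinOfCliques r a b = partitionGraph (cliqueColouring r a b) := by
  ext u v
  rcases u with u | u | u <;> rcases v with v | v | v <;>
    simp [joinOfCliques, join, partitionGraph, cliqueColouring]

theorem card_cliqueColouring (r a b : ℕ) :
    #{v | cliqueColouring r a b v = 0} = r ∧ #{v | cliqueColouring r a b v = 1} = a ∧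
      #{v | cliqueColouring r a b v = 2} = b := by
  simp only [Finset.card_filter, Fintype.sum_sum_type]
  simp [cliqueColouring]

theorem nonempty_iso_partitionGraph {V W : Type*} [Fintype V] [Fintype W] {c : V → Fin 3}
    {c' : W → Fin 3} (h : ∀ i, #{v | c v = i} = #{w | c' w = i}) :
    Nonempty (partitionGraph c ≃g partitionGraph c') := by
  have e : ∀ i, Nonempty ({v // c v = i} ≃ {w // c' w = i}) := fun i ↦
    Fintype.card_eq.1 (by rw [Fintype.card_subtype, Fintype.card_subtype, h])
  let E : V ≃ W := (Equiv.sigmaFiberEquiv c).symm.trans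
    ((Equiv.sigmaCongrRight fun i ↦ (e i).some).trans (Equiv.sigmaFiberEquiv c'))
  have hE : ∀ v, c' (E v) = c v := fun v ↦ ((e (c v)).some ⟨v, rfl⟩).2
  exact ⟨⟨E, by simp [partitionGraph, hE]⟩⟩

end Isomorphism

/-! ### Vertex cuts, minimum degree and the colouring -/

section Connectivity

variable {V : Type*} {G : SimpleGraph V}

theorem vertexConnectivity_le_card {S : Finset V} (hS : IsVertexCut G S) :
    vertexConnectivity G ≤ #S :=
  Nat.sInf_le ⟨S, hS, rfl⟩

theorem exists_isVertexCut_card_eq (h : vertexConnectivity G ≠ 0) :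
    ∃ S : Finset V, IsVertexCut G S ∧ #S = vertexConnectivity G :=
  Nat.sInf_mem (Nat.nonempty_of_sInf_eq_succ (Nat.succ_pred_eq_of_ne_zero h).symm)

variable [Fintype V]

/-- Deleting the neighbours of `v` isolates `v` or leaves it alone. -/
theorem isVertexCut_neighborFinset [DecidableRel G.Adj] (v : V) :
    IsVertexCut G (G.neighborFinset v) := by
  by_cases hv : {u | u ∉ G.neighborFinset v} = ({v} : Set V)
  · exact Or.inr ⟨v, hv⟩
  · left
    have hmem : v ∉ G.neighborFinset v := by simp
    obtain ⟨w, hw, hwv⟩ : ∃ w, w ∉ G.neighborFinset v ∧ w ≠ v := by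
      by_contra! hne
      refine hv (Set.ext fun w ↦ ⟨hne w, ?_⟩)
      rintro rfl
      exact hmem
    intro hpre
    have : Nontrivial {u | u ∉ G.neighborFinset v} :=
      ⟨⟨⟨v, hmem⟩, ⟨w, hw⟩, fun e ↦ hwv (congrArg Subtype.val e).symm⟩⟩
    obtain ⟨⟨u, hu⟩, hadj⟩ := hpre.exists_adj_of_nontrivial ⟨v, hmem⟩
    exact hu (by simpa using hadj)

theorem vertexConnectivity_le_minDegree [Nonempty V] [DecidableRel G.Adj] :
    vertexConnectivity G ≤ G.minDegree := by
  obtain ⟨v, hv⟩ := G.exists_minimal_degree_vertex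
  rw [hv, ← G.card_neighborFinset_eq_degree]
  exact vertexConnectivity_le_card (isVertexCut_neighborFinset v)

/-- A set whose removal disconnects the graph gives a colouring with two non-empty classes that
are not joined by edges. -/
theorem exists_le_partitionGraph {S : Finset V} (hS : ¬ (G.induce {v | v ∉ S}).Preconnected) :
    ∃ c : V → Fin 3, G ≤ partitionGraph c ∧ (∀ v, c v = 0 ↔ v ∈ S) ∧ (∃ v, c v = 1) ∧
      (∃ v, c v = 2) ∧ #{v | c v = 1} ≤ #{v | c v = 2} := by
  classical
  unfold SimpleGraph.Preconnected at hS
  push Not at hS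
  obtain ⟨⟨x, hx⟩, ⟨y, hy⟩, hxy⟩ := hS
  -- `P` is the component of `x` in `G - S`.
  obtain ⟨P, hP, hPS, hPx, hPy⟩ : ∃ P : V → Prop,
      (∀ u v, G.Adj u v → v ∉ S → P u → P v) ∧ (∀ v, P v → v ∉ S) ∧ P x ∧ ¬ P y :=
    ⟨fun v ↦ ∃ h : v ∉ S, (G.induce {v | v ∉ S}).Reachable ⟨x, hx⟩ ⟨v, h⟩,
      fun u v huv hv ⟨hu, h⟩ ↦ ⟨hv, h.trans (SimpleGraph.Adj.reachable (by simpa using huv))⟩,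
      fun v h ↦ h.1, ⟨hx, .rfl⟩, fun ⟨_, h⟩ ↦ hxy h⟩
  clear hxy
  replace hx : x ∉ S := hx
  replace hy : y ∉ S := hy
  -- The colours stay free so that the smaller side can receive `1`.
  have main : ∀ i j : Fin 3, i ≠ 0 → j ≠ 0 → i ≠ j →
      ∃ c : V → Fin 3, G ≤ partitionGraph c ∧ (∀ v, c v = 0 ↔ v ∈ S) ∧ c x = i ∧ c y = j ∧
        (∀ v, c v = i ↔ P v) ∧ (∀ v, c v = j ↔ v ∉ S ∧ ¬ P v) := by
    intro i j hi hj hij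
    refine ⟨fun v ↦ if v ∈ S then 0 else if P v then i else j, fun u v huv ↦ ⟨huv.ne, ?_⟩,
      ?_, ?_, ?_, ?_, ?_⟩
    · have h1 := hP u v huv
      have h2 := hP v u huv.symm
      grind
    · grind
    · grind
    · grind
    · grind
    · grind
  by_cases hle : #{v | P v} ≤ #{v | v ∉ S ∧ ¬ P v}
  · obtain ⟨c, h1, h2, h3, h4, h5, h6⟩ := main 1 2 (by decide) (by decide) (by decide)
    exact ⟨c, h1, h2, ⟨x, h3⟩, ⟨y, h4⟩, by simpa only [h5, h6] using hle⟩
  · obtain ⟨c, h1, h2, h3, h4, h5, h6⟩ := main 2 1 (by decide) (by decide) (by decide)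
    exact ⟨c, h1, h2, ⟨y, h4⟩, ⟨x, h3⟩, by simpa only [h5, h6] using (not_le.1 hle).le⟩

/-- The closed neighbourhood of `v` lies in class `0` together with the class of `v`. -/
theorem minDegree_lt_card_add_card [DecidableRel G.Adj] {c : V → Fin 3}
    (hG : G ≤ partitionGraph c) (v : V) (hv : c v ≠ 0) :
    G.minDegree < #{u | c u = 0} + #{u | c u = c v} := by
  classical
  have hsub : insert v (G.neighborFinset v) ⊆
      ({u | c u = 0} : Finset V) ∪ ({u | c u = c v} : Finset V) := by
    intro u hu
    rcases Finset.mem_insert.1 hu with rfl | hu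
    · simp
    · obtain ⟨-, h⟩ := hG ((G.mem_neighborFinset v u).1 hu)
      simp only [Finset.mem_union, Finset.mem_filter, Finset.mem_univ, true_and]
      tauto
  have h1 := (Finset.card_le_card hsub).trans (Finset.card_union_le _ _)
  rw [Finset.card_insert_of_notMem (by simp), G.card_neighborFinset_eq_degree] at h1
  have := G.minDegree_le_degree v
  omega

theorem card_eq_sum_card_colouring (c : V → Fin 3) :
    Fintype.card V = #{v | c v = 0} + #{v | c v = 1} + #{v | c v = 2} := by
  rw [← Finset.card_univ, Finset.card_eq_sum_card_fiberwise (f := c) (t := univ) (by simp),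
    Fin.sum_univ_three]

end Connectivity

end SpanningTreeCount

/-! ### The bound and the equality case -/

theorem theorem3p1 {V : Type*} [Fintype V] (G : SimpleGraph V) [DecidableRel G.Adj]
    (n r δ : ℕ) (hr : 1 ≤ r) (hn : Fintype.card V = n)
    (hκ : SpanningTreeCount.vertexConnectivity G = r) (hδ : G.minDegree = δ)
    (hnδ : 2 * (δ + 1) ≤ n + r) :
    SpanningTreeCount.numSpanningTrees G ≤
        r * n ^ (r - 1) * (δ + 1) ^ (δ - r) * (r + n - δ - 1) ^ (n - δ - 2) ∧
      (SpanningTreeCount.numSpanningTrees G =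
          r * n ^ (r - 1) * (δ + 1) ^ (δ - r) * (r + n - δ - 1) ^ (n - δ - 2) ↔
        Nonempty (G ≃g SpanningTreeCount.joinOfCliques r (δ - r + 1) (n - δ - 1))) := by
  open SpanningTreeCount Finset in
  classical
  obtain ⟨S, hS, hSr⟩ := exists_isVertexCut_card_eq (G := G) (by omega)
  rw [hκ] at hSr
  have hne : Nonempty V := by
    obtain ⟨v, -⟩ := Finset.card_pos.1 (by omega : 0 < #S)
    exact ⟨v⟩
  have hrδ : r ≤ δ := hκ ▸ hδ ▸ vertexConnectivity_le_minDegree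
  have hcut : ¬ (G.induce {v | v ∉ S}).Preconnected := by
    rcases hS with hS | ⟨v, hv⟩
    · exact hS
    -- A single remaining vertex would give `n = r + 1`, too small for the bound on `n`.
    · have h1 : Sᶜ = {v} := by
        ext u
        simpa using Set.ext_iff.1 hv u
      have h2 := Finset.card_add_card_compl S
      rw [h1, Finset.card_singleton] at h2
      omega
  obtain ⟨c, hG, hc0, ⟨v₁, hv₁⟩, ⟨v₂, hv₂⟩, hle⟩ := exists_le_partitionGraph hcut
  have hcard0 : #{v | c v = 0} = r := by simp [hc0, hSr]
  have hd1 := minDegree_lt_card_add_card hG v₁ (by simp [hv₁])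
  have hd2 := minDegree_lt_card_add_card hG v₂ (by simp [hv₂])
  have hsum := card_eq_sum_card_colouring c
  rw [hv₁] at hd1
  rw [hv₂] at hd2
  have hv₀ : ∃ v, c v = 0 := by
    obtain ⟨v, hv⟩ := Finset.card_pos.1 (by omega : 0 < #{v | c v = 0})
    exact ⟨v, (Finset.mem_filter.1 hv).2⟩
  obtain ⟨v₀, hv₀⟩ := hv₀
  obtain ⟨s, rfl⟩ : ∃ s, r = s + 1 := ⟨r - 1, by omega⟩
  obtain ⟨a₀, rfl⟩ : ∃ a₀, δ = a₀ + (s + 1) := ⟨δ - (s + 1), by omega⟩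
  -- `k` is the excess of the smaller side over its least size `δ - r + 1 = a₀ + 1`.
  obtain ⟨k, hk⟩ : ∃ k, #{v | c v = 1} = a₀ + k + 1 := ⟨#{v | c v = 1} - a₀ - 1, by omega⟩
  obtain ⟨b, hb⟩ : ∃ b, #{v | c v = 2} = b + 1 := ⟨#{v | c v = 2} - 1, by omega⟩
  obtain rfl : n = s + a₀ + (b + k) + 3 := by omega
  have e1 : s + 1 + (s + a₀ + (b + k) + 3) - (a₀ + (s + 1)) - 1 = b + k + s + 2 := by omega
  have e2 : s + a₀ + (b + k) + 3 - (a₀ + (s + 1)) - 2 = b + k := by omega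
  have e3 : s + a₀ + (b + k) + 3 - (a₀ + (s + 1)) - 1 = b + k + 1 := by omega
  have e4 : a₀ + (s + 1) - (s + 1) = a₀ := by omega
  have e5 : a₀ + (s + 1) + 1 = a₀ + s + 2 := by omega
  rw [e1, e2, e3, e4, e5, Nat.add_sub_cancel]
  have hτ := numSpanningTrees_partitionGraph c hcard0 hk hb
  have hmono := numSpanningTrees_mono hG
  obtain ⟨hJ0, hJ1, hJ2⟩ := card_cliqueColouring (s + 1) (a₀ + 1) (b + k + 1)
  have hJ : numSpanningTrees (joinOfCliques (s + 1) (a₀ + 1) (b + k + 1)) =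
      (s + 1) * (s + a₀ + (b + k) + 3) ^ s * (a₀ + s + 2) ^ a₀ * (b + k + s + 2) ^ (b + k) := by
    rw [joinOfCliques_eq_partitionGraph]
    exact numSpanningTrees_partitionGraph _ hJ0 hJ1 hJ2
  cases k with
  | zero =>
    have hτ' : numSpanningTrees (partitionGraph c) = (s + 1) * (s + a₀ + (b + 0) + 3) ^ s *
        (a₀ + s + 2) ^ a₀ * (b + 0 + s + 2) ^ (b + 0) := hτ
    refine ⟨hmono.trans hτ'.le, fun h ↦ ?_, fun ⟨e⟩ ↦ (numSpanningTrees_congr e).trans hJ⟩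
    rcases hG.lt_or_eq with hlt | rfl
    · have := numSpanningTrees_lt hlt (connected_partitionGraph hv₀)
      omega
    · rw [joinOfCliques_eq_partitionGraph]
      refine nonempty_iso_partitionGraph fun i ↦ ?_
      fin_cases i
      · exact hcard0.trans hJ0.symm
      · exact hk.trans hJ1.symm
      · exact hb.trans hJ2.symm
  | succ k =>
    -- Moving the `k + 1` excess vertices to the larger side strictly raises the count, so equality
    -- is impossible.
    have hconv := add_pow_mul_add_pow_lt (s + 2) (by omega) (show a₀ < b by omega) k
    have hlt : numSpanningTrees (partitionGraph c) < (s + 1) * (s + a₀ + (b + (k + 1)) + 3) ^ s *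
        (a₀ + s + 2) ^ a₀ * (b + (k + 1) + s + 2) ^ (b + (k + 1)) := by
      rw [hτ, mul_assoc, mul_assoc _ ((a₀ + s + 2) ^ a₀),
        show s + (a₀ + (k + 1)) + b + 3 = s + a₀ + (b + (k + 1)) + 3 by omega]
      exact Nat.mul_lt_mul_of_pos_left hconv (by positivity)
    exact ⟨(hmono.trans_lt hlt).le, fun h ↦ absurd h (hmono.trans_lt hlt).ne,
      fun ⟨e⟩ ↦ (numSpanningTrees_congr e).trans hJ⟩
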